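/- Let $\mathbf{Vect}(\mathbb C)$ be the category of topological complex vector spaces (not assumed Hausdorff or locally convex) and continuous $\mathbb C$-linear maps. It is symmetric monoidal closed: the internal hom $(V,W)$ is the space of continuous linear maps $V\to W$ with the topology of pointwise convergence, and $V\otimes W$ is the algebraic tensor product with the finest vector space topology for which $(v,w)\mapsto v\otimes w$ is separately continuous; the unit is $\mathbb C$. Let $\mathcal P(\mathbb C)$ be the full subcategory of those $V$ that are isomorphic to a linear subspace (with the subspace topology) of a power $\mathbb C^I$ (with the product topology), $I$ a set. Then $\mathcal P(\mathbb C)$ is a $\mathbb C$-linear $*$-autonomous category with dualizing object $\mathbb C$. Precisely: 1. $\mathcal P(\mathbb C)$ is reflective in $\mathbf{Vect}(\mathbb C)$ and carries a symmetric monoidal closed structure for which the reflector $L:\mathbf{Vect}(\mathbb C)\to\mathcal P(\mathbb C)$ is a strong symmetric monoidal functor (so the tensor product of $V,W\in\mathcal P(\mathbb C)$ is $L(V\otimes W)$). The inclusion, with the lax monoidal structure that corresponds to this under the adjunction, preserves internal homs: the internal hom of $V,W\in\mathcal P(\mathbb C)$ is $(V,W)$, compatibly with evaluation. 2. The tensor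 product of $\mathcal P(\mathbb C)$ is $\mathbb C$-bilinear on morphisms, with respect to the usual $\mathbb C$-linear structure on the spaces of morphisms. 3. Every $V\in\mathcal P(\mathbb C)$ is reflexive: the map $V\to((V,\mathbb C),\mathbb C)$, $v\mapsto(\varphi\mapsto\varphi(v))$, is an isomorphism of topological vector spaces. 4. $\mathbb C$ is a dualizing object of $\mathcal P(\mathbb C)$: writing $A^*$ for the internal hom from $A$ to $\mathbb C$, the canonical map $A\to A^{**}$ (the transpose of evaluation) is an isomorphism for every $A\in\mathcal P(\mathbb C)$. 5. There are $\mathbb C$-linear isomorphisms $\mathcal P(\mathbb C)(A\otimes B,X)\cong\mathcal P(\mathbb C)(A,(B\otimes X^*)^*)$, natural in $A,B,X\in\mathcal P(\mathbb C)$. -/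

import Mathlib

open CategoryTheory MonoidalCategory TensorProduct

universe u

/-! ### The symmetric monoidal closed category of topological complex vector spaces

The objects of `TopModuleCat ℂ` are the topological vector spaces over `ℂ` (not assumed to be
Hausdorff or locally convex), its morphisms are the continuous linear maps. -/

namespace TVS

noncomputable section

/-- The finest vector space topology on the algebraic tensor product for which the canonical
bilinear map `(v, w) ↦ v ⊗ₜ w` is separately continuous. -/
abbrev tensorTopology (V W : TopModuleCat.{u} ℂ) : TopologicalSpace (V ⊗[ℂ] W) :=
  sInf {t | @ContinuousAdd _ t _ ∧ @ContinuousSMul ℂ _ _ _ t ∧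
    (∀ v : V, @Continuous _ _ _ t fun w : W ↦ v ⊗ₜ[ℂ] w) ∧
    (∀ w : W, @Continuous _ _ _ t fun v : V ↦ v ⊗ₜ[ℂ] w)}

/-- The tensor product of topological vector spaces classifying the separately continuous
bilinear maps. -/
def tensorObj (V W : TopModuleCat.{u} ℂ) : TopModuleCat.{u} ℂ :=
  letI := tensorTopology V W
  haveI : ContinuousAdd (V ⊗[ℂ] W) := continuousAdd_sInf fun _ h ↦ h.1
  haveI : ContinuousSMul ℂ (V ⊗[ℂ] W) := continuousSMul_sInf fun _ h ↦ h.2.1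
  .of ℂ (V ⊗[ℂ] W)

/-- The pure tensor `v ⊗ w`, as an element of the topological tensor product. -/
def tmul {V W : TopModuleCat.{u} ℂ} (v : V) (w : W) : tensorObj V W :=
  (v ⊗ₜ[ℂ] w : V ⊗[ℂ] W)

lemma continuous_tmul_right {V W : TopModuleCat.{u} ℂ} (v : V) :
    Continuous fun w : W ↦ tmul v w :=
  continuous_sInf_rng.2 fun _ h ↦ h.2.2.1 v

lemma continuous_tmul_left {V W : TopModuleCat.{u} ℂ} (w : W) :
    Continuous fun v : V ↦ tmul v w :=
  continuous_sInf_rng.2 fun _ h ↦ h.2.2.2 w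

/-- A linear map on the tensor product is continuous as soon as the corresponding bilinear map is
separately continuous. -/
def lift {V W Z : TopModuleCat.{u} ℂ} (f : V ⊗[ℂ] W →ₗ[ℂ] Z)
    (h₁ : ∀ v : V, Continuous fun w : W ↦ f (v ⊗ₜ w))
    (h₂ : ∀ w : W, Continuous fun v : V ↦ f (v ⊗ₜ w)) : tensorObj V W ⟶ Z :=
  ConcreteCategory.ofHom (C := TopModuleCat ℂ)
    ({ toLinearMap := f
       cont := continuous_iff_le_induced.2 (sInf_le
        ⟨continuousAdd_induced f, continuousSMul_induced f,
          fun v ↦ continuous_induced_rng.2 (h₁ v), fun w ↦ continuous_induced_rng.2 (h₂ w)⟩) } :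
      tensorObj V W →L[ℂ] Z)

lemma lift_tmul {V W Z : TopModuleCat.{u} ℂ} (f : V ⊗[ℂ] W →ₗ[ℂ] Z) (h₁) (h₂) (v : V) (w : W) :
    (lift f h₁ h₂).hom (tmul v w) = f (v ⊗ₜ w) := rfl

lemma hom_ext' {V W Z : TopModuleCat.{u} ℂ} {f g : tensorObj V W ⟶ Z}
    (h : ∀ v w, f.hom (tmul v w) = g.hom (tmul v w)) : f = g := by
  have key : (f.hom.toLinearMap : V ⊗[ℂ] W →ₗ[ℂ] Z) = g.hom.toLinearMap :=
    TensorProduct.ext' h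
  refine ConcreteCategory.ext (ContinuousLinearMap.ext fun x ↦ ?_)
  exact LinearMap.congr_fun key x

lemma hom_ext₃ {V W Z X : TopModuleCat.{u} ℂ} {f g : tensorObj (tensorObj V W) Z ⟶ X}
    (h : ∀ v w z, f.hom (tmul (tmul v w) z) = g.hom (tmul (tmul v w) z)) : f = g := by
  have key : (f.hom.toLinearMap : (V ⊗[ℂ] W) ⊗[ℂ] Z →ₗ[ℂ] X) = g.hom.toLinearMap :=
    TensorProduct.ext_threefold h
  exact ConcreteCategory.ext (ContinuousLinearMap.ext fun x ↦ LinearMap.congr_fun key x)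

lemma hom_ext₃' {V W Z X : TopModuleCat.{u} ℂ} {f g : tensorObj V (tensorObj W Z) ⟶ X}
    (h : ∀ v w z, f.hom (tmul v (tmul w z)) = g.hom (tmul v (tmul w z))) : f = g := by
  have key : (f.hom.toLinearMap : V ⊗[ℂ] (W ⊗[ℂ] Z) →ₗ[ℂ] X) = g.hom.toLinearMap :=
    TensorProduct.ext (LinearMap.ext fun v ↦ TensorProduct.ext' (h v))
  exact ConcreteCategory.ext (ContinuousLinearMap.ext fun x ↦ LinearMap.congr_fun key x)

lemma hom_ext₄ {U V W Z X : TopModuleCat.{u} ℂ}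
    {f g : tensorObj (tensorObj (tensorObj U V) W) Z ⟶ X}
    (h : ∀ u v w z, f.hom (tmul (tmul (tmul u v) w) z) = g.hom (tmul (tmul (tmul u v) w) z)) :
    f = g := by
  have key : (f.hom.toLinearMap : ((U ⊗[ℂ] V) ⊗[ℂ] W) ⊗[ℂ] Z →ₗ[ℂ] X) = g.hom.toLinearMap :=
    TensorProduct.ext_fourfold h
  exact ConcreteCategory.ext (ContinuousLinearMap.ext fun x ↦ LinearMap.congr_fun key x)

/-- The tensor product of two continuous linear maps. -/
def tensorHom {V V' W W' : TopModuleCat.{u} ℂ} (f : V ⟶ V') (g : W ⟶ W') :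
    tensorObj V W ⟶ tensorObj V' W' :=
  lift (Z := tensorObj V' W') (TensorProduct.map f.hom.toLinearMap g.hom.toLinearMap)
    (fun v ↦ (continuous_tmul_right (f.hom v)).comp g.hom.continuous)
    (fun w ↦ (continuous_tmul_left (g.hom w)).comp f.hom.continuous)

/-- The unit object: the scalar field `ℂ` (lifted to the universe at hand). -/
def unit : TopModuleCat.{u} ℂ := .of ℂ (ULift.{u} ℂ)

lemma continuous_assoc_right (V W Z : TopModuleCat.{u} ℂ) (x : V ⊗[ℂ] W) :
    @Continuous Z (tensorObj V (tensorObj W Z)) _ _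
      fun z ↦ TensorProduct.assoc ℂ V W Z (x ⊗ₜ z) := by
  induction x using TensorProduct.induction_on with
  | zero =>
    simp only [TensorProduct.zero_tmul, map_zero]
    exact continuous_const
  | tmul v w =>
    exact (continuous_tmul_right (W := tensorObj W Z) v).comp (continuous_tmul_right w)
  | add x y hx hy =>
    simp only [TensorProduct.add_tmul, map_add]
    exact Continuous.add (M := tensorObj V (tensorObj W Z)) hx hy

lemma continuous_assoc_symm_left (V W Z : TopModuleCat.{u} ℂ) (x : W ⊗[ℂ] Z) :
    @Continuous V (tensorObj (tensorObj V W) Z) _ _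
      fun v ↦ (TensorProduct.assoc ℂ V W Z).symm (v ⊗ₜ x) := by
  induction x using TensorProduct.induction_on with
  | zero =>
    simp only [TensorProduct.tmul_zero, map_zero]
    exact continuous_const
  | tmul w z =>
    exact (continuous_tmul_left (V := tensorObj V W) z).comp (continuous_tmul_left w)
  | add x y hx hy =>
    simp only [TensorProduct.tmul_add, map_add]
    exact Continuous.add (M := tensorObj (tensorObj V W) Z) hx hy

/-- The associator `(v ⊗ w) ⊗ z ↦ v ⊗ (w ⊗ z)`. -/
def associator (V W Z : TopModuleCat.{u} ℂ) :
    tensorObj (tensorObj V W) Z ≅ tensorObj V (tensorObj W Z) where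
  hom := lift (V := tensorObj V W) (Z := tensorObj V (tensorObj W Z))
    (TensorProduct.assoc ℂ V W Z).toLinearMap
    (continuous_assoc_right V W Z)
    (fun z ↦ (lift (Z := tensorObj V (tensorObj W Z))
      ((TensorProduct.assoc ℂ V W Z).toLinearMap ∘ₗ (TensorProduct.mk ℂ (V ⊗[ℂ] W) Z).flip z)
      (fun v ↦ (continuous_tmul_right (W := tensorObj W Z) v).comp (continuous_tmul_left z))
      (fun w ↦ continuous_tmul_left (W := tensorObj W Z) (tmul w z))).hom.continuous)
  inv := lift (W := tensorObj W Z) (Z := tensorObj (tensorObj V W) Z)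
    (TensorProduct.assoc ℂ V W Z).symm.toLinearMap
    (fun v ↦ (lift (Z := tensorObj (tensorObj V W) Z)
      ((TensorProduct.assoc ℂ V W Z).symm.toLinearMap ∘ₗ TensorProduct.mk ℂ V (W ⊗[ℂ] Z) v)
      (fun w ↦ continuous_tmul_right (V := tensorObj V W) (tmul v w))
      (fun z ↦ (continuous_tmul_left (V := tensorObj V W) z).comp
        (continuous_tmul_right v))).hom.continuous)
    (continuous_assoc_symm_left V W Z)
  hom_inv_id := hom_ext₃ fun _ _ _ ↦ rfl
  inv_hom_id := hom_ext₃' fun _ _ _ ↦ rfl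

/-- The braiding `v ⊗ w ↦ w ⊗ v`. -/
def braiding (V W : TopModuleCat.{u} ℂ) : tensorObj V W ≅ tensorObj W V where
  hom := lift (Z := tensorObj W V) (TensorProduct.comm ℂ V W).toLinearMap
    (fun v ↦ continuous_tmul_left v) (fun w ↦ continuous_tmul_right w)
  inv := lift (Z := tensorObj V W) (TensorProduct.comm ℂ W V).toLinearMap
    (fun v ↦ continuous_tmul_left v) (fun w ↦ continuous_tmul_right w)
  hom_inv_id := hom_ext' fun _ _ ↦ rfl
  inv_hom_id := hom_ext' fun _ _ ↦ rfl

/-- The left unitor `c ⊗ v ↦ c • v`. -/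
def leftUnitor (V : TopModuleCat.{u} ℂ) : tensorObj unit V ≅ V where
  hom := lift (V := unit)
    (TensorProduct.lift ((LinearMap.lsmul ℂ V).comp (ULift.moduleEquiv (R := ℂ)).toLinearMap))
    (fun c ↦ continuous_const_smul (ULift.down c))
    (fun v ↦ continuous_uliftDown.smul continuous_const)
  inv := ConcreteCategory.ofHom (C := TopModuleCat ℂ)
    ({ toLinearMap := TensorProduct.mk ℂ (ULift.{u} ℂ) V ⟨1⟩
       cont := continuous_tmul_right (V := unit) ⟨1⟩ } : V →L[ℂ] tensorObj unit V)
  hom_inv_id := hom_ext' fun c v ↦ by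
    change (⟨1⟩ : ULift.{u} ℂ) ⊗ₜ[ℂ] (c.down • v) = c ⊗ₜ[ℂ] v
    rw [← TensorProduct.smul_tmul]
    congr 1
    ext
    simp
  inv_hom_id := ConcreteCategory.ext (ContinuousLinearMap.ext fun v ↦ one_smul ℂ v)

/-- The right unitor `v ⊗ c ↦ c • v`. -/
def rightUnitor (V : TopModuleCat.{u} ℂ) : tensorObj V unit ≅ V :=
  braiding V unit ≪≫ leftUnitor V

instance : MonoidalCategoryStruct (TopModuleCat.{u} ℂ) where
  tensorObj := tensorObj
  tensorHom := tensorHom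
  whiskerLeft V _ _ f := tensorHom (𝟙 V) f
  whiskerRight f W := tensorHom f (𝟙 W)
  tensorUnit := unit
  associator := associator
  leftUnitor := leftUnitor
  rightUnitor := rightUnitor

instance : MonoidalCategory (TopModuleCat.{u} ℂ) :=
  MonoidalCategory.ofTensorHom
    (id_tensorHom_id := fun _ _ ↦ hom_ext' fun _ _ ↦ rfl)
    (id_tensorHom := fun _ _ _ _ ↦ rfl)
    (tensorHom_id := fun _ _ ↦ rfl)
    (tensorHom_comp_tensorHom := fun _ _ _ _ ↦ hom_ext' fun _ _ ↦ rfl)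
    (associator_naturality := fun _ _ _ ↦ hom_ext₃ fun _ _ _ ↦ rfl)
    (leftUnitor_naturality := fun f ↦ hom_ext' fun c v ↦ (f.hom.map_smul c.down v).symm)
    (rightUnitor_naturality := fun f ↦ hom_ext' fun v c ↦ (f.hom.map_smul c.down v).symm)
    (pentagon := fun _ _ _ _ ↦ hom_ext₄ fun _ _ _ _ ↦ by rfl)
    (triangle := fun V W ↦ hom_ext₃ fun v c w ↦
      (TensorProduct.smul_tmul c.down (v : V) (w : W)).symm)

instance : SymmetricCategory (TopModuleCat.{u} ℂ) where
  braiding := braiding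
  braiding_naturality_right _ _ _ _ := hom_ext' fun _ _ ↦ rfl
  braiding_naturality_left _ _ := hom_ext' fun _ _ ↦ rfl
  hexagon_forward _ _ _ := hom_ext₃ fun _ _ _ ↦ rfl
  hexagon_reverse _ _ _ := hom_ext₃' fun _ _ _ ↦ rfl
  symmetry _ _ := hom_ext' fun _ _ ↦ rfl

/-- The internal hom: continuous linear maps with the topology of pointwise convergence. -/
def pointwiseHom (V W : TopModuleCat.{u} ℂ) : TopModuleCat.{u} ℂ :=
  haveI : ContinuousSMul ℂ (V →Lₚₜ[ℂ] W) :=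
    UniformConvergenceCLM.continuousSMul (RingHom.id ℂ) W {s : Set V | Finite s}
      fun _ hs ↦ Set.Finite.isVonNBounded hs
  .of ℂ (V →Lₚₜ[ℂ] W)

/-- The internal hom out of `V`, as a functor acting by postcomposition. -/
def pointwiseHomFunctor (V : TopModuleCat.{u} ℂ) : TopModuleCat.{u} ℂ ⥤ TopModuleCat.{u} ℂ where
  obj W := pointwiseHom V W
  map {W Z} f := ConcreteCategory.ofHom (C := TopModuleCat ℂ)
    (X := pointwiseHom V W) (Y := pointwiseHom V Z)
    (PointwiseConvergenceCLM.postcomp (σ := RingHom.id ℂ) (ρ := RingHom.id ℂ) V f.hom)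

/-- A morphism `V ⊗ W ⟶ Z` is the same thing as a morphism from `W` to the space of continuous
linear maps from `V` to `Z` with the topology of pointwise convergence. -/
def curryEquiv (V W Z : TopModuleCat.{u} ℂ) : (tensorObj V W ⟶ Z) ≃ (W ⟶ pointwiseHom V Z) where
  toFun f := ConcreteCategory.ofHom (C := TopModuleCat ℂ) (X := W) (Y := pointwiseHom V Z)
    { toFun w := (f.hom).comp
        ({ toLinearMap := (TensorProduct.mk ℂ V W).flip w
           cont := continuous_tmul_left w } : V →L[ℂ] tensorObj V W)
      map_add' w w' := ContinuousLinearMap.ext fun v ↦ by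
        change f.hom ((v ⊗ₜ[ℂ] (w + w') : V ⊗[ℂ] W)) = _
        rw [TensorProduct.tmul_add]
        exact map_add f.hom (tmul v w) (tmul v w')
      map_smul' c w := ContinuousLinearMap.ext fun v ↦ by
        change f.hom ((v ⊗ₜ[ℂ] (c • w) : V ⊗[ℂ] W)) = _
        rw [TensorProduct.tmul_smul]
        exact map_smul f.hom c (tmul v w)
      cont := PointwiseConvergenceCLM.continuous_of_continuous_eval fun v ↦
        f.hom.continuous.comp (continuous_tmul_right v) }
  invFun g := lift
    (TensorProduct.lift (((PointwiseConvergenceCLM.coeLM ℂ V Z).comp g.hom.toLinearMap).flip))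
    (fun v ↦ (PointwiseConvergenceCLM.evalCLM (RingHom.id ℂ) Z v).continuous.comp
      g.hom.continuous)
    (fun w ↦ ContinuousLinearMap.continuous (g.hom w : V →L[ℂ] Z))
  left_inv _ := hom_ext' fun _ _ ↦ rfl
  right_inv _ := rfl

/-- The tensor product with `V` is left adjoint to the internal hom out of `V`. -/
def tensorHomAdjunction (V : TopModuleCat.{u} ℂ) : tensorLeft V ⊣ pointwiseHomFunctor V :=
  Adjunction.mkOfHomEquiv
    { homEquiv W Z := curryEquiv V W Z
      homEquiv_naturality_left_symm _ _ := hom_ext' fun _ _ ↦ rfl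
      homEquiv_naturality_right _ _ := rfl }

instance : MonoidalClosed (TopModuleCat.{u} ℂ) where
  closed V := ⟨pointwiseHomFunctor V, tensorHomAdjunction V⟩

/-! ### Subspaces of powers of `ℂ` -/

/-- `V` is (isomorphic to) a linear subspace, with the subspace topology, of a power `ℂ ^ ι` with
the product topology. -/
def IsSubspaceOfPower : ObjectProperty (TopModuleCat.{u} ℂ) := fun V ↦
  ∃ (ι : Type u) (f : V →L[ℂ] (ι → ℂ)), Topology.IsEmbedding f

/-- The full subcategory `𝒫(ℂ)` of the subspaces of powers of `ℂ`. -/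
abbrev SubPow : Type (u + 1) := IsSubspaceOfPower.{u}.FullSubcategory

lemma isSubspaceOfPower_unit : IsSubspaceOfPower.{u} (𝟙_ (TopModuleCat.{u} ℂ)) := by
  refine ⟨PUnit, ⟨LinearMap.pi fun _ ↦ (ULift.moduleEquiv (R := ℂ)).toLinearMap,
    continuous_pi fun _ ↦ continuous_uliftDown⟩, ?_⟩
  exact (Homeomorph.funUnique PUnit.{u + 1} ℂ).symm.isEmbedding.comp
    Topology.IsEmbedding.uliftDown

/-- The scalar field `ℂ`, as an object of `𝒫(ℂ)`. -/
def scalars : SubPow.{u} := ⟨𝟙_ (TopModuleCat.{u} ℂ), isSubspaceOfPower_unit⟩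

end

end TVS

/-! ### Dualizing objects in symmetric monoidal closed categories -/

namespace StarAut

universe v w

variable {C : Type w} [Category.{v} C] [MonoidalCategory C] [MonoidalClosed C]

/-- The dual `A* = [A, D]` with respect to an object `D`. -/
def dual (D A : C) : C := (ihom A).obj D

/-- The contravariant action of `(-)* = [-, D]` on morphisms. -/
def dualMap (D : C) {A B : C} (f : A ⟶ B) : dual D B ⟶ dual D A :=
  (MonoidalClosed.pre f).app D

/-- The canonical map `A ⟶ A**`, the transpose of the evaluation `A* ⊗ A ≅ A ⊗ A* ⟶ D`. -/
def toDoubleDual [SymmetricCategory C] (D A : C) : A ⟶ dual D (dual D A) :=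
  MonoidalClosed.curry ((β_ (dual D A) A).hom ≫ (ihom.ev A).app D)

/-- `D` is a dualizing object: every canonical map `A ⟶ A**` is an isomorphism. A symmetric
monoidal closed category with a dualizing object is a *-autonomous category. -/
def IsDualizing [SymmetricCategory C] (D : C) : Prop := ∀ A : C, IsIso (toDoubleDual D A)

end StarAut

/-! Reflection: the reflector sends `V` to its image in `ℂ ^ V'`, where `V'` is the set of
continuous functionals on `V`. A map from `V` into a subspace of a power of `ℂ` has functionals on
`V` as coordinates, so it factors through this image (`exists_toReflection_comp`). Monoidal
structure: pointwise convergence makes `(V, W)` a subspace of `W ^ V`, so `𝒫(ℂ)` is an exponential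
ideal. By currying, the maps inverted by the reflector are then stable under tensoring
(`invertedByReflector.whiskerLeft`); hence the tensor product descends to the localization, which is
`𝒫(ℂ)` (Day's reflection theorem). Maps `V ⊗ Y ⟶ X` in `𝒫(ℂ)` correspond to maps out of the ambient
tensor product (`bijective_μ_comp_map`), which transports internal homs and bilinearity. Duality: a
functional on `V'` that is continuous for pointwise convergence is controlled by finitely many
evaluations, hence is a combination of them, and so is evaluation at a single vector
(`evalDual_surjective`). If `V` lies in a power of `ℂ`, its coordinates show that `V → V**` is an
embedding (`isEmbedding_evalDual`). The canonical map of `𝒫(ℂ)` is this one (`toDoubleDual_hom`), so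
`ℂ` is dualizing. The last isomorphism is formal: `(A ⊗ B, X) ≅ ((A ⊗ B) ⊗ X*, ℂ) ≅ ((B ⊗ X*) ⊗ A,
ℂ) ≅ (A, (B ⊗ X*)*)`. -/

namespace StarAut

-- Formal consequences of a dualizing object.

universe v w

variable {C : Type w} [Category.{v} C] [MonoidalCategory C] [MonoidalClosed C]

/-- The evaluation `X ⊗ X* ⟶ D`. -/
def dualEv (D X : C) : X ⊗ dual D X ⟶ D :=
  (ihom.ev X).app D

/-- Morphisms `A ⊗ Y ⟶ D` correspond to morphisms `Y ⟶ A*`. -/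
def dualCurry {D A Y : C} (g : A ⊗ Y ⟶ D) : Y ⟶ dual D A :=
  MonoidalClosed.curry g

lemma whiskerLeft_dualCurry {D A Y : C} (g : A ⊗ Y ⟶ D) : A ◁ dualCurry g ≫ dualEv D A = g :=
  MonoidalClosed.whiskerLeft_curry_ihom_ev_app A D g

lemma dualCurry_whiskerLeft {D A Y : C} (f : Y ⟶ dual D A) : dualCurry (A ◁ f ≫ dualEv D A) = f :=
  MonoidalClosed.curry_uncurry f

lemma dualCurry_natural {D A Y Y' : C} (f : Y' ⟶ Y) (g : A ⊗ Y ⟶ D) :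
    dualCurry (A ◁ f ≫ g) = f ≫ dualCurry g :=
  MonoidalClosed.curry_natural_left f g

lemma dualCurry_comp_dualMap {D A B Y : C} (f : B ⟶ A) (g : A ⊗ Y ⟶ D) :
    dualCurry g ≫ dualMap D f = dualCurry (f ▷ Y ≫ g) :=
  MonoidalClosed.curry_pre_app f g

lemma whiskerLeft_dualMap (D : C) {X X' : C} (x : X ⟶ X') :
    X ◁ dualMap D x ≫ dualEv D X = x ▷ dual D X' ≫ dualEv D X' :=
  MonoidalClosed.id_tensor_pre_app_comp_ev x D

/-- The correspondence between morphisms `A ⊗ Y ⟶ D` and `Y ⟶ A*`, as a linear equivalence. -/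
def dualCurryLinearEquiv (R : Type*) [CommRing R] [Preadditive C] [Linear R C]
    [MonoidalPreadditive C] [MonoidalLinear R C] (D A Y : C) :
    (A ⊗ Y ⟶ D) ≃ₗ[R] (Y ⟶ dual D A) :=
  LinearEquiv.symm
    { toFun f := A ◁ f ≫ dualEv D A
      invFun := dualCurry
      map_add' f g := by
        simp only [MonoidalPreadditive.whiskerLeft_add, Preadditive.add_comp]
      map_smul' c f := by
        simp only [MonoidalLinear.whiskerLeft_smul, Linear.smul_comp, RingHom.id_apply]
      left_inv := dualCurry_whiskerLeft
      right_inv := whiskerLeft_dualCurry }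

/-- The pairing `Y ⊗ X* ⟶ D` attached to a morphism `Y ⟶ X`. -/
def pairing (D : C) {Y X : C} (f : Y ⟶ X) : Y ⊗ dual D X ⟶ D :=
  f ▷ dual D X ≫ dualEv D X

lemma comp_pairing (D : C) {Z Y X : C} (g : Z ⟶ Y) (f : Y ⟶ X) :
    pairing D (g ≫ f) = g ▷ dual D X ≫ pairing D f := by
  simp [pairing]

/-- Dinaturality of evaluation: `x` may act on `X` or, dually, on `X'*`. -/
lemma pairing_comp (D : C) {Y X X' : C} (f : Y ⟶ X) (x : X ⟶ X') :
    pairing D (f ≫ x) = Y ◁ dualMap D x ≫ pairing D f := by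
  rw [pairing, pairing, whisker_exchange_assoc, comp_whiskerRight, Category.assoc,
    whiskerLeft_dualMap]

variable [SymmetricCategory C]

lemma toDoubleDual_eq (D A : C) :
    toDoubleDual D A = dualCurry ((β_ (dual D A) A).hom ≫ dualEv D A) :=
  rfl

lemma comp_toDoubleDual (D : C) {X Y : C} (f : Y ⟶ X) :
    f ≫ toDoubleDual D X = dualCurry ((β_ (dual D X) Y).hom ≫ pairing D f) := by
  rw [toDoubleDual_eq, ← dualCurry_natural, BraidedCategory.braiding_naturality_right_assoc,
    pairing]

/-- Up to braiding and currying, pairing is postcomposition with `X ⟶ X**`. This is where the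
dualizing hypothesis enters. -/
lemma bijective_pairing {D : C} (hD : IsDualizing D) (Y X : C) :
    Function.Bijective (pairing D : (Y ⟶ X) → _) := by
  have := hD X
  have hc : Function.Bijective (dualCurry : (dual D X ⊗ Y ⟶ D) → _) :=
    ((ihom.adjunction _).homEquiv _ _).bijective
  have hb := ((β_ (dual D X) Y).symm.homFromEquiv (Z := D)).bijective
  rw [← (hc.comp hb).of_comp_iff']
  have h : (dualCurry ∘ (β_ (dual D X) Y).symm.homFromEquiv) ∘ pairing D =
      fun f : Y ⟶ X ↦ f ≫ toDoubleDual D X := by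
    funext f
    rw [comp_toDoubleDual]
    rfl
  rw [h]
  exact ((asIso (toDoubleDual D X)).homToEquiv (Z := Y)).bijective

/-- The passage from a morphism `(A ⊗ B) ⊗ Z ⟶ D` to the corresponding morphism
`(B ⊗ Z) ⊗ A ⟶ D`. -/
def rotate {D A B Z : C} (g : (A ⊗ B) ⊗ Z ⟶ D) : (B ⊗ Z) ⊗ A ⟶ D :=
  (α_ A B Z ≪≫ β_ A (B ⊗ Z)).inv ≫ g

variable (R : Type*) [CommRing R] [Preadditive C] [Linear R C] [MonoidalPreadditive C]
  [MonoidalLinear R C]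

/-- The pairing with the dual of `X`, as a linear map. -/
def pairingLinearMap (D Y X : C) : (Y ⟶ X) →ₗ[R] (Y ⊗ dual D X ⟶ D) where
  toFun := pairing D
  map_add' f g := by
    simp only [pairing, MonoidalPreadditive.add_whiskerRight, Preadditive.add_comp]
  map_smul' c f := by
    simp only [pairing, MonoidalLinear.smul_whiskerRight, Linear.smul_comp, RingHom.id_apply]

/-- In a linear category with dualizing object `D`, a morphism `A ⊗ B ⟶ X` is the same thing as a
morphism `A ⟶ (B ⊗ X*)*`. -/
noncomputable def homEquivDual {D : C} (hD : IsDualizing D) (A B X : C) :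
    (A ⊗ B ⟶ X) ≃ₗ[R] (A ⟶ dual D (B ⊗ dual D X)) :=
  (LinearEquiv.ofBijective (pairingLinearMap R D (A ⊗ B) X) (bijective_pairing hD _ _)) ≪≫ₗ
    Linear.homCongr R ((α_ A B (dual D X)) ≪≫ (β_ A (B ⊗ dual D X))) (Iso.refl D) ≪≫ₗ
    dualCurryLinearEquiv R D (B ⊗ dual D X) A

/-- In this form, naturality in each variable reduces to naturality of the associator, the braiding
and the pairing. -/
lemma homEquivDual_apply {D : C} (hD : IsDualizing D) {A B X : C} (f : A ⊗ B ⟶ X) :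
    homEquivDual R hD A B X f = dualCurry (rotate (pairing D f)) := by
  change dualCurry (Linear.homCongr R _ _ (pairing D f)) = _
  rw [Linear.homCongr_apply, Iso.refl_hom, Category.comp_id, rotate]

lemma homEquivDual_natural_left {D : C} (hD : IsDualizing D) {A A' B X : C} (a : A' ⟶ A)
    (f : A ⊗ B ⟶ X) :
    homEquivDual R hD A' B X (a ▷ B ≫ f) = a ≫ homEquivDual R hD A B X f := by
  rw [homEquivDual_apply, homEquivDual_apply, ← dualCurry_natural, comp_pairing]
  simp only [rotate, Iso.trans_inv, Category.assoc, associator_inv_naturality_left_assoc,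
    BraidedCategory.braiding_inv_naturality_right_assoc]

lemma homEquivDual_natural_middle {D : C} (hD : IsDualizing D) {A B B' X : C} (b : B' ⟶ B)
    (f : A ⊗ B ⟶ X) :
    homEquivDual R hD A B' X (A ◁ b ≫ f) =
      homEquivDual R hD A B X f ≫ dualMap D (b ▷ dual D X) := by
  rw [homEquivDual_apply, homEquivDual_apply, dualCurry_comp_dualMap, comp_pairing]
  simp only [rotate, Iso.trans_inv, Category.assoc, associator_inv_naturality_middle_assoc,
    BraidedCategory.braiding_inv_naturality_left_assoc]

lemma homEquivDual_natural_right {D : C} (hD : IsDualizing D) {A B X X' : C} (x : X ⟶ X')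
    (f : A ⊗ B ⟶ X) :
    homEquivDual R hD A B X' (f ≫ x) =
      homEquivDual R hD A B X f ≫ dualMap D (B ◁ dualMap D x) := by
  rw [homEquivDual_apply, homEquivDual_apply, dualCurry_comp_dualMap, pairing_comp]
  simp only [rotate, Iso.trans_inv, Category.assoc, associator_inv_naturality_right_assoc,
    BraidedCategory.braiding_inv_naturality_left_assoc]

end StarAut

/-! ### Monoidal adjunctions with fully faithful right adjoint. -/

namespace CategoryTheory.Adjunction

open Functor.LaxMonoidal Functor.OplaxMonoidal

variable {C D : Type*} [Category* C] [Category* D] [MonoidalCategory C] [MonoidalCategory D]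
  {F : C ⥤ D} {G : D ⥤ C} (adj : F ⊣ G)

section

variable [F.Monoidal] [G.LaxMonoidal] [adj.IsMonoidal]

include adj

/-- Doctrinal adjunction: the lax structure of `G` is the mate of the oplax structure of `F`. -/
lemma μ_comp_map {V Y X : D} (f : V ⊗ Y ⟶ X) :
    μ G V Y ≫ G.map f =
      adj.homEquiv _ _ (δ F _ _ ≫ (adj.counit.app V ⊗ₘ adj.counit.app Y) ≫ f) := by
  rw [IsMonoidal.leftAdjoint_μ (adj := adj), Adjunction.homEquiv_unit]
  simp only [Functor.map_comp, Category.assoc]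

/-- For a fully faithful lax monoidal right adjoint of a strong monoidal functor, precomposition
with the lax structure is a bijection. -/
lemma bijective_μ_comp_map [G.Full] [G.Faithful] (V Y X : D) :
    Function.Bijective fun f : V ⊗ Y ⟶ X ↦ μ G V Y ≫ G.map f := by
  -- `δ` is invertible because `F` is strong monoidal, the counit because `G` is fully faithful.
  let i : F.obj (G.obj V ⊗ G.obj Y) ≅ V ⊗ Y :=
    (Functor.Monoidal.μIso F (G.obj V) (G.obj Y)).symm ≪≫
      asIso (adj.counit.app V ⊗ₘ adj.counit.app Y)
  have h : (fun f : V ⊗ Y ⟶ X ↦ μ G V Y ≫ G.map f) =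
      adj.homEquiv _ _ ∘ (i.homFromEquiv (Z := X)).symm := by
    funext f
    rw [adj.μ_comp_map f]
    simp [i]
  rw [h]
  exact (adj.homEquiv _ _).bijective.comp (i.homFromEquiv (Z := X)).symm.bijective

variable [G.Full] [G.Faithful]

/-- The tensor product of a monoidal reflective subcategory is bilinear. -/
lemma monoidalPreadditive [Preadditive C] [Preadditive D] [MonoidalPreadditive C] [G.Additive] :
    MonoidalPreadditive D where
  -- Injectivity reduces each identity to `C`, once naturality of `μ` has moved the whiskering
  -- there.
  whiskerLeft_zero := (adj.bijective_μ_comp_map _ _ _).1 (by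
    simp only [← μ_natural_right, Functor.map_zero, MonoidalPreadditive.whiskerLeft_zero,
      Limits.zero_comp, Limits.comp_zero])
  zero_whiskerRight := (adj.bijective_μ_comp_map _ _ _).1 (by
    simp only [← μ_natural_left, Functor.map_zero, MonoidalPreadditive.zero_whiskerRight,
      Limits.zero_comp, Limits.comp_zero])
  whiskerLeft_add f g := (adj.bijective_μ_comp_map _ _ _).1 (by
    simp only [← μ_natural_right, Functor.map_add, MonoidalPreadditive.whiskerLeft_add,
      Preadditive.add_comp, Preadditive.comp_add])
  add_whiskerRight f g := (adj.bijective_μ_comp_map _ _ _).1 (by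
    simp only [← μ_natural_left, Functor.map_add, MonoidalPreadditive.add_whiskerRight,
      Preadditive.add_comp, Preadditive.comp_add])

lemma monoidalLinear (R : Type*) [Semiring R] [Preadditive C] [Preadditive D] [Linear R C]
    [Linear R D] [MonoidalPreadditive C] [MonoidalPreadditive D] [MonoidalLinear R C]
    [G.Linear R] : MonoidalLinear R D where
  whiskerLeft_smul V _ _ r f := (adj.bijective_μ_comp_map _ _ _).1 (by
    simp only [← μ_natural_right, Functor.map_smul, MonoidalLinear.whiskerLeft_smul,
      Linear.smul_comp, Linear.comp_smul])
  smul_whiskerRight r _ _ f V := (adj.bijective_μ_comp_map _ _ _).1 (by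
    simp only [← μ_natural_left, Functor.map_smul, MonoidalLinear.smul_whiskerRight,
      Linear.smul_comp, Linear.comp_smul])

end

/-- The lax structure on the right adjoint of a braided functor is compatible with the braidings. -/
lemma μ_comp_map_braiding [BraidedCategory C] [BraidedCategory D] [F.Braided] [G.LaxMonoidal]
    [adj.IsMonoidal] (X Y : D) :
    μ G X Y ≫ G.map (β_ X Y).hom = (β_ (G.obj X) (G.obj Y)).hom ≫ μ G Y X := by
  -- With the identity in place of `f`, `μ` itself is a transpose; both sides become transposes of
  -- maps that agree because `F` is braided.
  have e := adj.μ_comp_map (𝟙 (Y ⊗ X))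
  rw [G.map_id, Category.comp_id] at e
  erw [Category.comp_id] at e
  rw [adj.μ_comp_map, e, ← adj.homEquiv_naturality_left, Functor.map_braiding]
  simp

end CategoryTheory.Adjunction

/-! ### Day's reflection theorem for exponential ideals. -/

namespace CategoryTheory.ObjectProperty

open Functor.LaxMonoidal

variable {D : Type*} [Category* D] [MonoidalCategory D]

/-- The internal homs into objects with the property `P` have the property `P`. -/
class IsExponentialIdeal [MonoidalClosed D] (P : ObjectProperty D) : Prop where
  prop_ihom (V W : D) : P W → P ((ihom V).obj W)

variable (P : ObjectProperty D) [Reflective P.ι]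

/-- The morphisms that the reflector inverts. -/
abbrev invertedByReflector : MorphismProperty D :=
  (MorphismProperty.isomorphisms P.FullSubcategory).inverseImage (reflector P.ι)

omit [MonoidalCategory D] in
-- By Yoneda and the adjunction, invertibility after reflection becomes a condition on hom-sets of
-- `D`, where currying is available.
lemma invertedByReflector_iff {X Y : D} (f : X ⟶ Y) :
    invertedByReflector P f ↔
      ∀ Z : D, P Z → Function.Bijective fun g : Y ⟶ Z ↦ f ≫ g := by
  refine (isLocal_iff_isIso_map (reflectorAdjunction P.ι) f).symm.trans ?_
  exact ⟨fun h Z hZ ↦ h Z ⟨⟨Z, hZ⟩, rfl⟩, fun h Z ⟨Z', hZ⟩ ↦ h Z (hZ ▸ Z'.2)⟩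

instance : (reflector P.ι).IsLocalization P.invertedByReflector :=
  (reflectorAdjunction P.ι).isLocalization

section

variable [MonoidalClosed D] [P.IsExponentialIdeal]

variable {P} in
-- Precomposing maps into `Z` with `V ◁ f` is, after currying, precomposing maps into `[V, Z]` with
-- `f`, and `[V, Z]` again has the property `P`.
lemma invertedByReflector.whiskerLeft {X Y : D} {f : X ⟶ Y} (hf : invertedByReflector P f)
    (V : D) : invertedByReflector P (V ◁ f) := by
  rw [invertedByReflector_iff] at hf ⊢
  intro Z hZ
  have h := hf _ (IsExponentialIdeal.prop_ihom V Z hZ)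
  have e : (fun g : V ⊗ Y ⟶ Z ↦ V ◁ f ≫ g) =
      (MonoidalClosed.uncurry ∘ fun g ↦ f ≫ g) ∘ MonoidalClosed.curry := by
    funext g
    simp [MonoidalClosed.uncurry_natural_left]
  rw [e]
  exact (((ihom.adjunction V).homEquiv _ _).symm.bijective.comp h).comp
    ((ihom.adjunction V).homEquiv _ _).bijective

variable [SymmetricCategory D]

instance : P.invertedByReflector.IsMonoidal where
  whiskerLeft V _ _ _ hf := invertedByReflector.whiskerLeft hf V
  whiskerRight f hf V :=
    (P.invertedByReflector.arrow_mk_iso_iff (Arrow.isoMk (β_ _ V) (β_ _ V))).2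
      (invertedByReflector.whiskerLeft hf V)

/-- The monoidal structure on a reflective exponential ideal. -/
@[reducible]
noncomputable def reflectiveMonoidalCategory : MonoidalCategory P.FullSubcategory :=
  -- `LocalizedMonoidal` is a synonym of the target category; `Iso.refl _` fixes the unit to be the
  -- reflection of the ambient unit.
  inferInstanceAs (MonoidalCategory
    (LocalizedMonoidal (reflector P.ι) P.invertedByReflector (Iso.refl _)))

attribute [local instance] reflectiveMonoidalCategory

/-- The symmetric monoidal structure on a reflective exponential ideal. -/
@[reducible]
noncomputable def reflectiveSymmetricCategory : SymmetricCategory P.FullSubcategory :=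
  inferInstanceAs (SymmetricCategory
    (LocalizedMonoidal (reflector P.ι) P.invertedByReflector (Iso.refl _)))

attribute [local instance] reflectiveSymmetricCategory

/-- The reflector onto a reflective exponential ideal is a symmetric monoidal functor. -/
@[reducible]
noncomputable def reflectorBraided : (reflector P.ι).Braided :=
  inferInstanceAs (Localization.Monoidal.toMonoidalCategory
    (reflector P.ι) P.invertedByReflector (Iso.refl _)).Braided

end

section

variable [MonoidalClosed D] [P.IsExponentialIdeal] [MonoidalCategory P.FullSubcategory]
  [(reflector P.ι).Monoidal] [P.ι.LaxMonoidal] [(reflectorAdjunction P.ι).IsMonoidal]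

/-- The internal hom out of `V`, as an endofunctor of an exponential ideal. -/
noncomputable def ihomLift (V : P.FullSubcategory) : P.FullSubcategory ⥤ P.FullSubcategory :=
  P.lift (P.ι ⋙ ihom V.obj) fun W ↦ IsExponentialIdeal.prop_ihom _ _ W.2

/-- The correspondence between morphisms out of a tensor product and morphisms into the internal
hom of a reflective exponential ideal. -/
noncomputable def ihomLiftHomEquiv (V Y X : P.FullSubcategory) :
    (V ⊗ Y ⟶ X) ≃ (Y ⟶ (P.ihomLift V).obj X) :=
  (Equiv.ofBijective _ ((reflectorAdjunction P.ι).bijective_μ_comp_map V Y X)).trans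
    (((ihom.adjunction V.obj).homEquiv Y.obj X.obj).trans
      (P.fullyFaithfulι.homEquiv (X := Y) (Y := (P.ihomLift V).obj X)).symm)

lemma ihomLiftHomEquiv_hom {V Y X : P.FullSubcategory} (f : V ⊗ Y ⟶ X) :
    (P.ihomLiftHomEquiv V Y X f).hom = MonoidalClosed.curry (μ P.ι V Y ≫ f.hom) :=
  rfl

lemma ihomLiftHomEquiv_natural_left {V Y Y' X : P.FullSubcategory} (g : Y' ⟶ Y) (f : V ⊗ Y ⟶ X) :
    P.ihomLiftHomEquiv V Y' X (V ◁ g ≫ f) = g ≫ P.ihomLiftHomEquiv V Y X f := by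
  ext1
  have h : μ P.ι V Y' ≫ (V ◁ g).hom = V.obj ◁ g.hom ≫ μ P.ι V Y :=
    (μ_natural_right P.ι V g).symm
  rw [ihomLiftHomEquiv_hom, FullSubcategory.comp_hom, FullSubcategory.comp_hom,
    ihomLiftHomEquiv_hom, reassoc_of% h]
  exact MonoidalClosed.curry_natural_left _ _

lemma ihomLiftHomEquiv_natural_right {V Y X X' : P.FullSubcategory} (f : V ⊗ Y ⟶ X)
    (g : X ⟶ X') :
    P.ihomLiftHomEquiv V Y X' (f ≫ g) = P.ihomLiftHomEquiv V Y X f ≫ (P.ihomLift V).map g := by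
  ext1
  rw [ihomLiftHomEquiv_hom, FullSubcategory.comp_hom, FullSubcategory.comp_hom,
    ihomLiftHomEquiv_hom, ← Category.assoc]
  exact MonoidalClosed.curry_natural_right _ _

/-- The adjunction between the tensor product and the internal hom of a reflective exponential
ideal. -/
noncomputable def tensorIhomLiftAdjunction (V : P.FullSubcategory) :
    tensorLeft V ⊣ P.ihomLift V :=
  Adjunction.mkOfHomEquiv
    { homEquiv Y X := P.ihomLiftHomEquiv V Y X
      homEquiv_naturality_left_symm f g := by
        rw [Equiv.symm_apply_eq]
        exact ((P.ihomLiftHomEquiv_natural_left f _).trans (by rw [Equiv.apply_symm_apply])).symm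
      homEquiv_naturality_right f g := P.ihomLiftHomEquiv_natural_right f g }

/-- The closed structure on a reflective exponential ideal. -/
@[reducible]
noncomputable def reflectiveMonoidalClosed : MonoidalClosed P.FullSubcategory where
  closed V := ⟨P.ihomLift V, P.tensorIhomLiftAdjunction V⟩

attribute [local instance] reflectiveMonoidalClosed

lemma reflectiveMonoidalClosed_curry {V Y X : P.FullSubcategory} (f : V ⊗ Y ⟶ X) :
    MonoidalClosed.curry f = P.ihomLiftHomEquiv V Y X f := by
  change (P.tensorIhomLiftAdjunction V).homEquiv Y X f = _
  rw [tensorIhomLiftAdjunction, Adjunction.mkOfHomEquiv_homEquiv]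

/-- The inclusion of a reflective exponential ideal preserves evaluation. -/
lemma reflectiveMonoidalClosed_ev (V X : P.FullSubcategory) :
    μ P.ι V ((ihom V).obj X) ≫ ((ihom.ev V).app X).hom = (ihom.ev V.obj).app X.obj := by
  -- In both categories the evaluation is the map whose transpose is the identity.
  have h : P.ihomLiftHomEquiv V _ X ((ihom.ev V).app X) = 𝟙 ((ihom V).obj X) := by
    rw [← reflectiveMonoidalClosed_curry]
    rw [← MonoidalClosed.uncurry_id_eq_ev, MonoidalClosed.curry_uncurry]
  have h' := congrArg InducedCategory.Hom.hom h
  rw [ihomLiftHomEquiv_hom] at h'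
  apply MonoidalClosed.curry_injective
  have e : MonoidalClosed.curry ((ihom.ev V.obj).app X.obj) = 𝟙 ((ihom V.obj).obj X.obj) := by
    rw [← MonoidalClosed.uncurry_id_eq_ev, MonoidalClosed.curry_uncurry]
  exact h'.trans e.symm

end

section

variable [SymmetricCategory D] [MonoidalClosed D] [P.IsExponentialIdeal]
  [MonoidalCategory P.FullSubcategory] [SymmetricCategory P.FullSubcategory]
  [(reflector P.ι).Braided] [P.ι.LaxMonoidal] [(reflectorAdjunction P.ι).IsMonoidal]

attribute [local instance] reflectiveMonoidalClosed

/-- The canonical map is built from braiding, evaluation and currying, and `μ` is compatible with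
all three; hence reflexivity can be tested in `D`. -/
lemma toDoubleDual_hom (A B : P.FullSubcategory) :
    (StarAut.toDoubleDual B A).hom = StarAut.toDoubleDual B.obj A.obj := by
  have h := (reflectorAdjunction P.ι).μ_comp_map_braiding ((ihom A).obj B) A
  rw [StarAut.toDoubleDual]
  erw [reflectiveMonoidalClosed_curry, ihomLiftHomEquiv_hom]
  refine congrArg MonoidalClosed.curry ?_
  refine (Category.assoc (μ P.ι ((ihom A).obj B) A) (β_ ((ihom A).obj B) A).hom.hom
    ((ihom.ev A).app B).hom).symm.trans ?_
  refine (congrArg (· ≫ _) h).trans ?_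
  refine (Category.assoc _ _ _).trans ?_
  exact congrArg (_ ≫ ·) (P.reflectiveMonoidalClosed_ev A B)

lemma isDualizing_of_reflexive (B : P.FullSubcategory)
    (h : ∀ A, P A → IsIso (StarAut.toDoubleDual B.obj A)) : StarAut.IsDualizing B := by
  intro A
  have : IsIso (P.ι.map (StarAut.toDoubleDual B A)) := by
    rw [ι_map, toDoubleDual_hom]
    exact h _ A.2
  exact isIso_of_fully_faithful P.ι _

end

end CategoryTheory.ObjectProperty

/-! ### The reflection of a topological vector space. -/

namespace TVS

noncomputable section

instance : MonoidalPreadditive (TopModuleCat.{u} ℂ) where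
  whiskerLeft_zero := hom_ext' fun _ _ ↦ TensorProduct.tmul_zero _ _
  zero_whiskerRight := hom_ext' fun _ _ ↦ TensorProduct.zero_tmul _ _
  whiskerLeft_add _ _ := hom_ext' fun _ _ ↦ TensorProduct.tmul_add _ _ _
  add_whiskerRight _ _ := hom_ext' fun _ _ ↦ TensorProduct.add_tmul _ _ _

instance : MonoidalLinear ℂ (TopModuleCat.{u} ℂ) where
  whiskerLeft_smul _ _ _ _ _ := hom_ext' fun _ _ ↦ TensorProduct.tmul_smul _ _ _
  smul_whiskerRight _ _ _ _ _ := hom_ext' fun _ _ ↦ TensorProduct.smul_tmul' _ _ _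

/-- A vector in `V`, evaluated at all continuous linear functionals. -/
def evalAll (V : TopModuleCat.{u} ℂ) : V →L[ℂ] ((V →L[ℂ] ℂ) → ℂ) :=
  ContinuousLinearMap.pi fun φ ↦ φ

/-- The universal quotient of `V` that embeds into a power of `ℂ`. -/
def reflection (V : TopModuleCat.{u} ℂ) : SubPow.{u} where
  obj := .of ℂ (evalAll V).toLinearMap.range
  -- The index set `V →L[ℂ] ℂ` lies in the same universe as `V`.
  property := ⟨_, (evalAll V).toLinearMap.range.subtypeL, Topology.IsEmbedding.subtypeVal⟩

/-- The canonical map from `V` to its reflection. -/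
def toReflection (V : TopModuleCat.{u} ℂ) : V ⟶ (reflection V).obj :=
  TopModuleCat.ofHom (X := V) ((evalAll V).codRestrict _ fun v ↦ ⟨v, rfl⟩)

lemma toReflection_surjective (V : TopModuleCat.{u} ℂ) :
    Function.Surjective (toReflection V).hom := by
  rintro ⟨_, v, rfl⟩
  exact ⟨v, rfl⟩

/-- The reflection has the subspace topology of the power, not the quotient topology of `V`; such a
`ψ` is continuous because it is the coordinate at `φ`. -/
lemma toReflection_continuous_of_comp {V : TopModuleCat.{u} ℂ} (φ : V →L[ℂ] ℂ)
    (ψ : (reflection V).obj → ℂ) (h : ∀ v, ψ ((toReflection V).hom v) = φ v) : Continuous ψ := by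
  have : ψ = fun y ↦ y.1 φ := by
    funext y
    obtain ⟨v, rfl⟩ := toReflection_surjective V y
    exact h v
  rw [this]
  exact (continuous_apply φ).comp continuous_subtype_val

/-- Each coordinate of `f` is a functional on `V`. Hence `f` vanishes wherever all functionals do,
and the coordinates of the induced map are coordinates of the reflection. -/
lemma exists_toReflection_comp {V W : TopModuleCat.{u} ℂ} (hW : IsSubspaceOfPower W) (f : V ⟶ W) :
    ∃ g : (reflection V).obj ⟶ W, toReflection V ≫ g = f := by
  obtain ⟨ι, j, hj⟩ := hW
  have hker : (toReflection V).hom.toLinearMap.ker ≤ f.hom.toLinearMap.ker := by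
    intro v hv
    have h0 : ∀ φ : V →L[ℂ] ℂ, φ v = 0 := fun φ ↦ congrFun (congrArg Subtype.val hv) φ
    refine hj.injective ?_
    funext i
    exact (h0 (((ContinuousLinearMap.proj i).comp j).comp f.hom)).trans
      (congrFun (map_zero j).symm i)
  let g : (reflection V).obj →ₗ[ℂ] W :=
    ((toReflection V).hom.toLinearMap.ker.liftQ f.hom.toLinearMap hker) ∘ₗ
      ((toReflection V).hom.toLinearMap.quotKerEquivOfSurjective
        (toReflection_surjective V)).symm.toLinearMap
  have hg (v : V) : g ((toReflection V).hom v) = f.hom v := by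
    have h := (toReflection V).hom.toLinearMap.quotKerEquivOfSurjective_symm_apply
      (toReflection_surjective V) v
    exact (congrArg ((toReflection V).hom.toLinearMap.ker.liftQ f.hom.toLinearMap hker) h).trans
      (Submodule.liftQ_apply _ _ _)
  have hcont : Continuous g := hj.continuous_iff.2 <| continuous_pi fun i ↦
    toReflection_continuous_of_comp (((ContinuousLinearMap.proj i).comp j).comp f.hom) _
      fun v ↦ congrFun (congrArg j (hg v)) i
  exact ⟨ConcreteCategory.ofHom (C := TopModuleCat ℂ) (⟨g, hcont⟩ : (reflection V).obj →L[ℂ] W),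
    ConcreteCategory.ext (ContinuousLinearMap.ext hg)⟩

lemma bijective_toReflection_comp (V : TopModuleCat.{u} ℂ) (W : SubPow.{u}) :
    Function.Bijective fun g : reflection V ⟶ W ↦ toReflection V ≫ g.hom := by
  refine ⟨fun g g' h ↦ ?_, fun f ↦ ?_⟩
  · ext1
    refine ConcreteCategory.ext (ContinuousLinearMap.ext fun y ↦ ?_)
    obtain ⟨v, rfl⟩ := toReflection_surjective V y
    exact ConcreteCategory.congr_hom h v
  · obtain ⟨g, hg⟩ := exists_toReflection_comp W.2 f
    exact ⟨ObjectProperty.homMk g, hg⟩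

instance : Reflective IsSubspaceOfPower.{u}.ι where
  L := Adjunction.leftAdjointOfEquiv (F_obj := reflection)
    (fun V W ↦ Equiv.ofBijective _ (bijective_toReflection_comp V W)) fun _ _ _ _ _ ↦ rfl
  adj := Adjunction.adjunctionOfEquivLeft _ _

instance : IsSubspaceOfPower.{u}.IsExponentialIdeal where
  prop_ihom V W := by
    rintro ⟨ι, j, hj⟩
    refine ⟨V × ι, ContinuousLinearMap.pi fun p ↦ ((ContinuousLinearMap.proj p.2).comp j).comp
      (PointwiseConvergenceCLM.evalCLM (RingHom.id ℂ) W p.1), ?_⟩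
    -- After currying, the map is the composite of the embeddings `(V, W) → W ^ V → (ℂ ^ ι) ^ V`.
    refine Topology.IsEmbedding.of_comp (ContinuousLinearMap.continuous _)
      (g := Function.curry) (continuous_pi fun v ↦ continuous_pi fun i ↦ continuous_apply (v, i)) ?_
    exact (Topology.IsEmbedding.piMap fun _ : V ↦ hj).comp
      (PointwiseConvergenceCLM.isEmbedding_coeFn (RingHom.id ℂ) V W)

/-! ### Reflexivity and the dualizing object. -/

/-- The evaluation of a functional at a vector, as a map into the double dual. -/
def evalDual (V : TopModuleCat.{u} ℂ) : V →L[ℂ] ((V →Lₚₜ[ℂ] ℂ) →Lₚₜ[ℂ] ℂ) where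
  toFun v := PointwiseConvergenceCLM.evalCLM (RingHom.id ℂ) ℂ v
  map_add' v w := ContinuousLinearMap.ext fun φ ↦ map_add (φ : V →L[ℂ] ℂ) v w
  map_smul' c v := ContinuousLinearMap.ext fun φ ↦ map_smul (φ : V →L[ℂ] ℂ) c v
  cont := PointwiseConvergenceCLM.continuous_of_continuous_eval fun φ ↦
    ContinuousLinearMap.continuous (φ : V →L[ℂ] ℂ)

/-- Every continuous linear functional on the space of continuous linear functionals on `V`, with
the topology of pointwise convergence, is the evaluation at some vector. -/
lemma evalDual_surjective (V : TopModuleCat.{u} ℂ) : Function.Surjective (evalDual V) := by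
  intro Λ
  let B : V →ₗ[ℂ] (V →Lₚₜ[ℂ] ℂ) →ₗ[ℂ] ℂ := (PointwiseConvergenceCLM.coeLM ℂ V ℂ).flip
  -- The topology of the dual is induced by the evaluations, so its continuous functionals are
  -- exactly their span; the range of `B` is already a subspace.
  have hΛ : Λ.toLinearMap ∈ Submodule.span ℂ (Set.range B) := by
    rw [LinearMap.mem_span_iff_continuous]
    have h := (PointwiseConvergenceCLM.isEmbedding_coeFn (RingHom.id ℂ) V ℂ).eq_induced
    rw [induced_to_pi] at h
    exact h ▸ Λ.continuous
  rw [← LinearMap.coe_range, Submodule.span_eq] at hΛ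
  obtain ⟨v, hv⟩ := hΛ
  exact ⟨v, ContinuousLinearMap.ext fun φ ↦ LinearMap.congr_fun hv φ⟩

/-- Evaluating a double dual vector at the coordinates of `j` recovers `j` on `V`, and the first
factor of an embedding into continuous maps is an embedding. -/
lemma isEmbedding_evalDual {V : TopModuleCat.{u} ℂ} (hV : IsSubspaceOfPower V) :
    Topology.IsEmbedding (evalDual V) := by
  obtain ⟨ι, j, hj⟩ := hV
  exact .of_comp (evalDual V).continuous
    (g := fun (Λ : (V →Lₚₜ[ℂ] ℂ) →Lₚₜ[ℂ] ℂ) (i : ι) ↦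
      Λ ((ContinuousLinearMap.proj i).comp j : V →L[ℂ] ℂ))
    (continuous_pi fun i ↦ (PointwiseConvergenceCLM.evalCLM (RingHom.id ℂ) ℂ _).continuous) hj

/-- A subspace of a power of `ℂ` is reflexive. -/
def evalDualEquiv {V : TopModuleCat.{u} ℂ} (hV : IsSubspaceOfPower V) :
    V ≃L[ℂ] ((V →Lₚₜ[ℂ] ℂ) →Lₚₜ[ℂ] ℂ) where
  toLinearEquiv := LinearEquiv.ofBijective (evalDual V).toLinearMap
    ⟨(isEmbedding_evalDual hV).injective, evalDual_surjective V⟩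
  continuous_toFun := (evalDual V).continuous
  continuous_invFun := (isEmbedding_evalDual hV).continuous_iff.2 <| by
    convert continuous_id using 1
    funext Λ
    exact (LinearEquiv.ofBijective (evalDual V).toLinearMap
      ⟨(isEmbedding_evalDual hV).injective, evalDual_surjective V⟩).apply_symm_apply Λ

lemma evalDualEquiv_apply {V : TopModuleCat.{u} ℂ} (hV : IsSubspaceOfPower V) (v : V)
    (φ : V →Lₚₜ[ℂ] ℂ) : evalDualEquiv hV v φ = φ v :=
  rfl

/-- The lifted scalars in place of `ℂ` give the same dual space. -/
def dualULiftEquiv (V : TopModuleCat.{u} ℂ) : pointwiseHom V unit ≃L[ℂ] (V →Lₚₜ[ℂ] ℂ) :=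
  let κ : unit.{u} ≃L[ℂ] ℂ := ContinuousLinearEquiv.ulift
  ContinuousLinearEquiv.equivOfInverse
    (PointwiseConvergenceCLM.postcomp (σ := RingHom.id ℂ) (ρ := RingHom.id ℂ) V
      (κ : unit.{u} →L[ℂ] ℂ))
    (PointwiseConvergenceCLM.postcomp (σ := RingHom.id ℂ) (ρ := RingHom.id ℂ) V
      (κ.symm : ℂ →L[ℂ] unit.{u}))
    (fun _ ↦ rfl) (fun _ ↦ rfl)

/-- The lifted scalars in place of `ℂ` give the same double dual space. -/
def doubleDualULiftEquiv (V : TopModuleCat.{u} ℂ) :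
    ((V →Lₚₜ[ℂ] ℂ) →Lₚₜ[ℂ] ℂ) ≃L[ℂ] pointwiseHom (pointwiseHom V unit) unit :=
  ContinuousLinearEquiv.trans
    (ContinuousLinearEquiv.equivOfInverse
      (PointwiseConvergenceCLM.precomp (τ := RingHom.id ℂ) (ρ := RingHom.id ℂ) ℂ
        (dualULiftEquiv V : pointwiseHom V unit →L[ℂ] (V →Lₚₜ[ℂ] ℂ)))
      (PointwiseConvergenceCLM.precomp (τ := RingHom.id ℂ) (ρ := RingHom.id ℂ) ℂ
        ((dualULiftEquiv V).symm : (V →Lₚₜ[ℂ] ℂ) →L[ℂ] pointwiseHom V unit))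
      (fun _ ↦ rfl) (fun _ ↦ rfl))
    (dualULiftEquiv (pointwiseHom V unit)).symm

/-- Replaces the abstract transposes by explicit ones, after which the comparison with
`evalDualEquiv` is definitional. -/
lemma toDoubleDual_eq_curryEquiv (V : TopModuleCat.{u} ℂ) :
    StarAut.toDoubleDual (𝟙_ (TopModuleCat.{u} ℂ)) V =
      curryEquiv (pointwiseHom V unit) V unit
        ((braiding (pointwiseHom V unit) V).hom ≫
          (curryEquiv V (pointwiseHom V unit) unit).symm (𝟙 (pointwiseHom V unit))) := by
  change (tensorHomAdjunction (pointwiseHom V unit)).homEquiv V unit _ = _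
  rw [tensorHomAdjunction, Adjunction.mkOfHomEquiv_homEquiv]
  rfl

lemma isIso_toDoubleDual {V : TopModuleCat.{u} ℂ} (hV : IsSubspaceOfPower V) :
    IsIso (StarAut.toDoubleDual (𝟙_ (TopModuleCat.{u} ℂ)) V) := by
  have h : StarAut.toDoubleDual (𝟙_ (TopModuleCat.{u} ℂ)) V =
      (TopModuleCat.ofIso (X := V) (Y := pointwiseHom (pointwiseHom V unit) unit)
        ((evalDualEquiv hV).trans (doubleDualULiftEquiv V))).hom := by
    rw [toDoubleDual_eq_curryEquiv]
    rfl
  rw [h]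
  exact Iso.isIso_hom (TopModuleCat.ofIso (X := V) (Y := pointwiseHom (pointwiseHom V unit) unit)
    ((evalDualEquiv hV).trans (doubleDualULiftEquiv V)))

end

end TVS

open TVS StarAut in
theorem proposition6 :
    ∃ (_ : Reflective IsSubspaceOfPower.{u}.ι)
      (_ : MonoidalCategory SubPow.{u})
      (_ : SymmetricCategory SubPow.{u})
      (_ : MonoidalClosed SubPow.{u})
      (_ : (reflector IsSubspaceOfPower.{u}.ι).Braided)
      (_ : IsSubspaceOfPower.{u}.ι.LaxMonoidal),
      (reflectorAdjunction IsSubspaceOfPower.{u}.ι).IsMonoidal ∧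
      (∀ V W : SubPow.{u}, ∃ e : ((ihom V).obj W).obj ≅ (ihom V.obj).obj W.obj,
        V.obj ◁ e.hom ≫ (ihom.ev V.obj).app W.obj =
          Functor.LaxMonoidal.μ IsSubspaceOfPower.{u}.ι V ((ihom V).obj W) ≫
            ((ihom.ev V).app W).hom) ∧
      (∃ _ : MonoidalPreadditive SubPow.{u}, MonoidalLinear ℂ SubPow.{u}) ∧
      (∀ V : SubPow.{u}, ∃ e : V.obj ≃L[ℂ] ((V.obj →Lₚₜ[ℂ] ℂ) →Lₚₜ[ℂ] ℂ),
        ∀ (v : V.obj) (φ : V.obj →Lₚₜ[ℂ] ℂ), e v φ = φ v) ∧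
      IsDualizing (scalars : SubPow.{u}) ∧
      ∃ Φ : ∀ A B X : SubPow.{u},
          (A ⊗ B ⟶ X) ≃ₗ[ℂ] (A ⟶ dual scalars (B ⊗ dual scalars X)),
        (∀ (A A' B X : SubPow.{u}) (a : A' ⟶ A) (f : A ⊗ B ⟶ X),
          Φ A' B X (a ▷ B ≫ f) = a ≫ Φ A B X f) ∧
        (∀ (A B B' X : SubPow.{u}) (b : B' ⟶ B) (f : A ⊗ B ⟶ X),
          Φ A B' X (A ◁ b ≫ f) = Φ A B X f ≫ dualMap scalars (b ▷ dual scalars X)) ∧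
        (∀ (A B X X' : SubPow.{u}) (x : X ⟶ X') (f : A ⊗ B ⟶ X),
          Φ A B X' (f ≫ x) = Φ A B X f ≫ dualMap scalars (B ◁ dualMap scalars x)) := by
  let P := IsSubspaceOfPower.{u}
  let : MonoidalCategory SubPow.{u} := P.reflectiveMonoidalCategory
  let : SymmetricCategory SubPow.{u} := P.reflectiveSymmetricCategory
  let : (reflector IsSubspaceOfPower.{u}.ι).Braided := P.reflectorBraided
  let : IsSubspaceOfPower.{u}.ι.LaxMonoidal :=
    (reflectorAdjunction IsSubspaceOfPower.{u}.ι).rightAdjointLaxMonoidal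
  have : (reflectorAdjunction IsSubspaceOfPower.{u}.ι).IsMonoidal := inferInstance
  let : MonoidalClosed SubPow.{u} := P.reflectiveMonoidalClosed
  have : MonoidalPreadditive SubPow.{u} :=
    (reflectorAdjunction IsSubspaceOfPower.{u}.ι).monoidalPreadditive
  have : MonoidalLinear ℂ SubPow.{u} :=
    (reflectorAdjunction IsSubspaceOfPower.{u}.ι).monoidalLinear ℂ
  have hD : IsDualizing (scalars : SubPow.{u}) :=
    P.isDualizing_of_reflexive scalars fun _ ↦ isIso_toDoubleDual
  -- The internal hom of `𝒫(ℂ)` was lifted from the ambient one, so the comparison isomorphism is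
  -- the identity.
  refine ⟨inferInstance, inferInstance, inferInstance, inferInstance, inferInstance,
    inferInstance, inferInstance, fun V W ↦ ⟨Iso.refl _, ?_⟩, ⟨inferInstance, inferInstance⟩,
    fun V ↦ ⟨evalDualEquiv V.2, evalDualEquiv_apply V.2⟩, hD, homEquivDual ℂ hD, ?_, ?_, ?_⟩
  · refine (congrArg (· ≫ _) (MonoidalCategory.whiskerLeft_id _ _)).trans ?_
    exact (Category.id_comp _).trans (P.reflectiveMonoidalClosed_ev V W).symm
  · exact fun _ _ _ _ a f ↦ homEquivDual_natural_left ℂ hD a f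
  · exact fun _ _ _ _ b f ↦ homEquivDual_natural_middle ℂ hD b f
  · exact fun _ _ _ _ x f ↦ homEquivDual_natural_right ℂ hD x f
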